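/- Let $P$ be a countable set of propositional variables with a fixed numbering $P\hookrightarrow\mathbb N$. Formulas are built from $P$ with $\neg,\to,\vee,\wedge$ and two unary connectives $\blacktriangle,\triangledown$. The logic IntGC (intuitionistic propositional logic with a Galois connection) is the smallest set of formulas (the *provable* ones) that contains intuitionistic propositional logic and is closed under substitution, modus ponens, and the rules: from $A\to\triangledown B$ infer $\blacktriangle A\to B$; from $\blacktriangle A\to B$ infer $A\to\triangledown B$. An *IntGC-model* $\mathcal M=(X,\le,R,v)$ consists of a non-empty set $X$, a preorder $\le$ on $X$, a relation $R$ on $X$ such that $x\ge y$, $y\,R\,z$, $z\ge w$ imply $x\,R\,w$, and a map $v$ assigning to each $p\in P$ a $\le$-upward closed subset $v(p)\subseteq X$. Satisfaction is given by $x\models p$ iff $x\in v(p)$; the usual clauses for $\wedge,\vee$; $x\models A\to B$ iff for all $y\ge x$, $y\models A$ implies $y\models B$; $x\models\neg A$ iff $y\not\models A$ for all $y\ge x$; $x\models\blacktriangle A$ iff there is $y$ with $x\,R\,y$ and $y\models A$; $x\models\triangledown A$ iff $y\models A$ for all $y$ with $y\,R\,x$. A formula is *valid* in $\mathcal M$ if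 all $x\in X$ satisfy it. For a formula $A$ let $\mathrm{Sub}(A)$ be the set of its subformulas, put $\Gamma=\mathrm{Sub}(A)\cup\{\triangledown\blacktriangle B\mid\blacktriangle B\in\mathrm{Sub}(A)\}\cup\{\blacktriangle\triangledown B\mid\triangledown B\in\mathrm{Sub}(A)\}$, and let $\Sigma_A$ consist of $\mathrm{Sub}(A)$ and of all formulas $(\triangledown\blacktriangle)^n\triangledown B$, $\blacktriangle(\triangledown\blacktriangle)^n\triangledown B$ with $n\ge0$, $\triangledown B\in\Gamma$, and $(\blacktriangle\triangledown)^n\blacktriangle B$, $\triangledown(\blacktriangle\triangledown)^n\blacktriangle B$ with $n\ge0$, $\blacktriangle B\in\Gamma$. The *filtration* $\mathcal M^f$ of a model $\mathcal M$ through a set $\Sigma$ of formulas is the model on the classes $[x]$ of worlds satisfying the same formulas of $\Sigma$, where $[x]\le^f[y]$ iff every $B\in\Sigma$ with $x\models B$ has $y\models B$; $[x]\,R^f\,[y]$ iff for every $B\in\Sigma$ with $\triangledown B\in\Sigma$, $y\models\triangledown B$ implies $x\models B$; and $v^f(p)=\{[x]\mid x\models p\}$ for $p\in\Sigma$, $v^f(p)=\emptyset$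 for the other variables. Then: 1. (Finite model property) Every formula that is not provable in IntGC fails to be valid in some finite IntGC-model. 2. For every formula $A$: $A\in\Sigma_A$; $\Sigma_A$ is closed under subformulas; $\Sigma_A$ splits into only finitely many classes of provably equivalent formulas; and whenever $A$ is not valid in an IntGC-model $\mathcal M$, the filtration of $\mathcal M$ through $\Sigma_A$ is a finite IntGC-model in which $A$ is not valid. 3. IntGC is decidable: there is a total computable function which, given the Gödel number of a formula, decides whether the formula is provable. -/

import Mathlib

universe u v

namespace IntGC

/-- Formulas over a set `P` of propositional variables.  The connectives are `¬`, `→`, `∨`, `∧`,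
`▲` (`up`) and `▽` (`down`). -/
inductive Formula (P : Type u) : Type u
  | var : P → Formula P
  | neg : Formula P → Formula P
  | imp : Formula P → Formula P → Formula P
  | disj : Formula P → Formula P → Formula P
  | conj : Formula P → Formula P → Formula P
  | up : Formula P → Formula P
  | down : Formula P → Formula P

namespace Formula

variable {P : Type u}

/-- `A ↔ B`, i.e. `(A → B) ∧ (B → A)`. -/
def equiv (A B : Formula P) : Formula P := conj (imp A B) (imp B A)

/-- Simultaneous substitution of formulas for variables. -/
def subst (s : P → Formula P) : Formula P → Formula P
  | var p => s p
  | neg A => neg (subst s A)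
  | imp A B => imp (subst s A) (subst s B)
  | disj A B => disj (subst s A) (subst s B)
  | conj A B => conj (subst s A) (subst s B)
  | up A => up (subst s A)
  | down A => down (subst s A)

/-- The set `Sub(A)` of subformulas of `A` (including `A`). -/
def sub : Formula P → Set (Formula P)
  | var p => {var p}
  | neg A => insert (neg A) (sub A)
  | imp A B => insert (imp A B) (sub A ∪ sub B)
  | disj A B => insert (disj A B) (sub A ∪ sub B)
  | conj A B => insert (conj A B) (sub A ∪ sub B)
  | up A => insert (up A) (sub A)
  | down A => insert (down A) (sub A)

/-- A Gödel numbering of the formulas, relative to a numbering of the variables. -/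
def code [Encodable P] : Formula P → ℕ
  | var p => Nat.pair 0 (Encodable.encode p)
  | neg A => Nat.pair 1 (code A)
  | imp A B => Nat.pair 2 (Nat.pair (code A) (code B))
  | disj A B => Nat.pair 3 (Nat.pair (code A) (code B))
  | conj A B => Nat.pair 4 (Nat.pair (code A) (code B))
  | up A => Nat.pair 5 (code A)
  | down A => Nat.pair 6 (code A)

theorem code_injective [Encodable P] : Function.Injective (code (P := P)) := by
  intro A
  induction A <;> intro B h <;> cases B <;> simp_all [code, Nat.pair_eq_pair] <;> grind

end Formula

open Formula

/-- Provability in IntGC: a Hilbert calculus for intuitionistic propositional logic with the rules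
of modus ponens, substitution, (GC1) and (GC2). -/
inductive Provable {P : Type u} : Formula P → Prop
  | imp_k (A B : Formula P) : Provable (imp A (imp B A))
  | imp_s (A B C : Formula P) :
      Provable (imp (imp A (imp B C)) (imp (imp A B) (imp A C)))
  | conj_left (A B : Formula P) : Provable (imp (conj A B) A)
  | conj_right (A B : Formula P) : Provable (imp (conj A B) B)
  | conj_intro (A B : Formula P) : Provable (imp A (imp B (conj A B)))
  | disj_left (A B : Formula P) : Provable (imp A (disj A B))
  | disj_right (A B : Formula P) : Provable (imp B (disj A B))
  | disj_elim (A B C : Formula P) :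
      Provable (imp (imp A C) (imp (imp B C) (imp (disj A B) C)))
  | neg_intro (A B : Formula P) :
      Provable (imp (imp A B) (imp (imp A (neg B)) (neg A)))
  | neg_elim (A B : Formula P) : Provable (imp (neg A) (imp A B))
  | subst (s : P → Formula P) {A : Formula P} : Provable A → Provable (A.subst s)
  | mp {A B : Formula P} : Provable (imp A B) → Provable A → Provable B
  | gc1 {A B : Formula P} : Provable (imp A (down B)) → Provable (imp (up A) B)
  | gc2 {A B : Formula P} : Provable (imp (up A) B) → Provable (imp A (down B))

/-- Kripke frames of IntGC: a preorder `le` on a non-empty set and a relation `R` such that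
`(≥ ∘ R ∘ ≥) ⊆ R`. -/
structure Frame where
  World : Type v
  nonempty : Nonempty World
  le : World → World → Prop
  le_refl : ∀ x, le x x
  le_trans : ∀ x y z, le x y → le y z → le x z
  R : World → World → Prop
  ge_R_ge : ∀ x y z w, le y x → R y z → le w z → R x w

/-- IntGC-models: a frame with a valuation of the variables by sets of worlds that are closed
upwards (persistence). -/
structure Model (P : Type u) extends Frame.{v} where
  val : P → Set World
  val_persistent : ∀ p x y, le x y → x ∈ val p → y ∈ val p

namespace Model

variable {P : Type u}

/-- The satisfiability relation `x ⊨ A`. -/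
def Sat (M : Model.{u, v} P) : M.World → Formula P → Prop
  | x, var p => x ∈ M.val p
  | x, neg A => ∀ y, M.le x y → ¬ M.Sat y A
  | x, imp A B => ∀ y, M.le x y → M.Sat y A → M.Sat y B
  | x, disj A B => M.Sat x A ∨ M.Sat x B
  | x, conj A B => M.Sat x A ∧ M.Sat x B
  | x, up A => ∃ y, M.R x y ∧ M.Sat y A
  | x, down A => ∀ y, M.R y x → M.Sat y A

/-- `A` is valid in the model. -/
def Valid (M : Model.{u, v} P) (A : Formula P) : Prop := ∀ x, M.Sat x A

/-- `x ∼ y`: the worlds `x` and `y` satisfy the same formulas of `S`. -/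
def filtSetoid (M : Model.{u, v} P) (S : Set (Formula P)) : Setoid M.World where
  r x y := ∀ B ∈ S, M.Sat x B ↔ M.Sat y B
  iseqv :=
    ⟨fun _ _ _ => Iff.rfl, fun h B hB => (h B hB).symm,
      fun h k B hB => (h B hB).trans (k B hB)⟩

/-- The filtration `(X/∼, ≤ᶠ, Rᶠ, vᶠ)` of a model through a set `S` of formulas:
* `[x] ≤ᶠ [y]` iff every `B ∈ S` with `x ⊨ B` has `y ⊨ B`;
* `[x] Rᶠ [y]` iff for every `B ∈ S` with `▽B ∈ S`, `y ⊨ ▽B` implies `x ⊨ B`;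
* `vᶠ(p) = {[x] | x ⊨ p}` for variables `p ∈ S` (and `∅` for the other variables).

The relations are stated for all representatives of the classes; since they depend on the classes
only, this is the same as stating them for some representatives (see `filtration_le_mk`,
`filtration_R_mk`, `filtration_val_mk`). -/
def filtration (M : Model.{u, v} P) (S : Set (Formula P)) : Model.{u, v} P where
  World := Quotient (M.filtSetoid S)
  nonempty := M.nonempty.map (Quotient.mk _)
  le a b := ∀ x y, Quotient.mk (M.filtSetoid S) x = a → Quotient.mk (M.filtSetoid S) y = b →
    ∀ B ∈ S, M.Sat x B → M.Sat y B
  le_refl a := by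
    intro x y hx hy B hB h
    exact (Quotient.exact (hx.trans hy.symm) B hB).1 h
  le_trans a b c hab hbc := by
    intro x z hx hz B hB h
    obtain ⟨y, hy⟩ := Quotient.exists_rep b
    exact hbc y z hy hz B hB (hab x y hx hy B hB h)
  R a b := ∀ x y, Quotient.mk (M.filtSetoid S) x = a → Quotient.mk (M.filtSetoid S) y = b →
    ∀ B ∈ S, down B ∈ S → M.Sat y (down B) → M.Sat x B
  ge_R_ge a b c d hba hbc hdc := by
    intro x w hx hw B hB hdB h
    obtain ⟨y, hy⟩ := Quotient.exists_rep b
    obtain ⟨z, hz⟩ := Quotient.exists_rep c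
    exact hba y x hy hx B hB (hbc y z hy hz B hB hdB (hdc w z hw hz _ hdB h))
  val p := {a | var p ∈ S ∧ ∃ x, Quotient.mk (M.filtSetoid S) x = a ∧ M.Sat x (var p)}
  val_persistent p a b hab := by
    rintro ⟨hp, x, hx, h⟩
    obtain ⟨y, hy⟩ := Quotient.exists_rep b
    exact ⟨hp, y, hy, hab x y hx hy _ hp h⟩

theorem filtration_le_mk (M : Model.{u, v} P) (S : Set (Formula P)) (x y : M.World) :
    (M.filtration S).le (Quotient.mk (M.filtSetoid S) x) (Quotient.mk (M.filtSetoid S) y) ↔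
      ∀ B ∈ S, M.Sat x B → M.Sat y B := by
  constructor
  · intro h
    exact h x y rfl rfl
  · intro h x' y' hx hy B hB hs
    exact (Quotient.exact hy B hB).2 (h B hB ((Quotient.exact hx B hB).1 hs))

theorem filtration_R_mk (M : Model.{u, v} P) (S : Set (Formula P)) (x y : M.World) :
    (M.filtration S).R (Quotient.mk (M.filtSetoid S) x) (Quotient.mk (M.filtSetoid S) y) ↔
      ∀ B ∈ S, down B ∈ S → M.Sat y (down B) → M.Sat x B := by
  constructor
  · intro h
    exact h x y rfl rfl
  · intro h x' y' hx hy B hB hdB hs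
    exact (Quotient.exact hx B hB).2 (h B hB hdB ((Quotient.exact hy _ hdB).1 hs))

theorem filtration_val_mk (M : Model.{u, v} P) (S : Set (Formula P)) (p : P) (hp : var p ∈ S)
    (x : M.World) :
    Quotient.mk (M.filtSetoid S) x ∈ (M.filtration S).val p ↔ M.Sat x (var p) := by
  constructor
  · rintro ⟨_, y, hy, h⟩
    exact (Quotient.exact hy _ hp).1 h
  · intro h
    exact ⟨hp, x, rfl, h⟩

end Model

variable {P : Type u}

/-- `Γ = Sub(A) ∪ {▽▲B | ▲B ∈ Sub(A)} ∪ {▲▽B | ▽B ∈ Sub(A)}`. -/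
def Gam (A : Formula P) : Set (Formula P) :=
  A.sub ∪ {C | ∃ B, up B ∈ A.sub ∧ C = down (up B)} ∪
    {C | ∃ B, down B ∈ A.sub ∧ C = up (down B)}

/-- The set `Σ`: `Sub(A)` together with all `(▽▲)ⁿ▽B` and `▲(▽▲)ⁿ▽B` with `▽B ∈ Γ`, and all
`(▲▽)ⁿ▲B` and `▽(▲▽)ⁿ▲B` with `▲B ∈ Γ`. -/
def Sig (A : Formula P) : Set (Formula P) :=
  A.sub ∪
    {C | ∃ (n : ℕ) (B : Formula P), down B ∈ Gam A ∧
      C = (fun D => down (up D))^[n] (down B)} ∪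
    {C | ∃ (n : ℕ) (B : Formula P), down B ∈ Gam A ∧
      C = up ((fun D => down (up D))^[n] (down B))} ∪
    {C | ∃ (n : ℕ) (B : Formula P), up B ∈ Gam A ∧
      C = (fun D => up (down D))^[n] (up B)} ∪
    {C | ∃ (n : ℕ) (B : Formula P), up B ∈ Gam A ∧
      C = down ((fun D => up (down D))^[n] (up B))}

/-- `S` is closed under subformulas. -/
def SubformulaClosed (S : Set (Formula P)) : Prop :=
  ∀ B ∈ S, ∀ C ∈ B.sub, C ∈ S

/-- The classes of provably equivalent formulas into which `S` is divided. -/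
def provClasses (S : Set (Formula P)) : Set (Set (Formula P)) :=
  (fun B => {C | C ∈ S ∧ Provable (equiv B C)}) '' S

/-- The finite model property: each formula that is not provable is refuted in a finite model. -/
def HasFMP (P : Type u) : Prop :=
  ∀ A : Formula P, ¬ Provable A → ∃ N : Model.{u, 0} P, Finite N.World ∧ ¬ N.Valid A

/-- Decidability: some total computable function decides, from the code of a formula, whether the
formula is provable. -/
def IsDecidable (P : Type u) [Encodable P] : Prop :=
  ∃ f : ℕ → Bool, Computable f ∧ ∀ A : Formula P, f A.code = true ↔ Provable A

end IntGC

/-!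
Completeness is the canonical model of prime theories; the case of `▲` separates the filter of `A`
from the directed set of the `▽B` with `B` missing.

For finite models, the Galois connection makes `▽▲▽` equivalent to `▽` and `▲▽▲` to `▲`, so that
`Σ_A` is finite up to provable equivalence. It is also closed under `▲B ↦ ▽▲B`, and this is what the
truth lemma needs for `▲`: the relation of the filtration respects `▽` by definition, and `y ⊨ B`
implies `y ⊨ ▽▲B`.

For decidability a smaller filtration suffices: if the relation is made to respect `▲` as well as
`▽`, then `Sub(A)` alone satisfies the truth lemma. An unprovable formula with code `c` is therefore
refuted by a model whose worlds are sets of numbers up to `c`. There are at most `2 ^ (2 ^ (c + 1))`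
sets of such worlds, and the truth conditions can be checked on the codes.
-/

universe w

namespace IntGC

/-! ### Primitive recursive search through bit sets -/

section BitSets

variable {α : Type*} [Primcodable α]

theorem primrecPred_imp {p q : α → Prop} (hp : PrimrecPred p) (hq : PrimrecPred q) :
    PrimrecPred fun x => p x → q x :=
  (hp.not.or hq).of_eq fun _ => imp_iff_not_or.symm

theorem primrecPred_iff {p q : α → Prop} (hp : PrimrecPred p) (hq : PrimrecPred q) :
    PrimrecPred fun x => p x ↔ q x :=
  ((primrecPred_imp hp hq).and (primrecPred_imp hq hp)).of_eq fun _ =>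
    iff_iff_implies_and_implies.symm

theorem primrec_two_pow : Primrec fun n : ℕ => 2 ^ n :=
  (Primrec₂.unpaired'.1 Nat.Primrec.pow).comp (.const 2) .id

theorem primrecRel_mem_bitIndices : PrimrecRel fun i n : ℕ => i ∈ n.bitIndices :=
  (Primrec.eq.comp
    (Primrec.nat_mod.comp (Primrec.nat_div.comp .snd (primrec_two_pow.comp .fst)) (.const 2))
    (.const 1)).of_eq fun _ => by simp [Nat.testBit_eq_decide_div_mod_eq]

theorem lt_of_mem_bitIndices {i n : ℕ} (h : i ∈ n.bitIndices) : i < n :=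
  Nat.lt_two_pow_self.trans_le (Nat.two_pow_le_of_mem_bitIndices h)

variable {s : α → ℕ} {p : α → ℕ → Prop}

theorem primrecPred_exists_lt (hs : Primrec s) (hp : PrimrecPred fun x : α × ℕ => p x.1 x.2) :
    PrimrecPred fun x => ∃ i < s x, p x i :=
  ((PrimrecRel.exists_mem_list (R := fun i x => p x i) (hp.comp (.pair .snd .fst))).comp
    (Primrec.list_range.comp hs) .id).of_eq fun _ => by simp only [List.mem_range, id]

theorem primrecPred_exists_mem_bitIndices (hs : Primrec s)
    (hp : PrimrecPred fun x : α × ℕ => p x.1 x.2) :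
    PrimrecPred fun x => ∃ i ∈ (s x).bitIndices, p x i :=
  (primrecPred_exists_lt (p := fun x i => i ∈ (s x).bitIndices ∧ p x i) hs
    ((primrecRel_mem_bitIndices.comp .snd (hs.comp .fst)).and hp)).of_eq fun _ =>
      exists_congr fun _ => and_iff_right_of_imp fun h => lt_of_mem_bitIndices h.1

theorem primrecPred_forall_mem_bitIndices (hs : Primrec s)
    (hp : PrimrecPred fun x : α × ℕ => p x.1 x.2) :
    PrimrecPred fun x => ∀ i ∈ (s x).bitIndices, p x i :=
  (primrecPred_exists_mem_bitIndices (p := fun x i => ¬ p x i) hs hp.not).not.of_eq fun _ => by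
    simp only [not_exists, not_and, not_not]

theorem exists_mem_bitIndices_iff {T : Set ℕ} {n : ℕ} (hT : ∀ i ∈ T, i < n) :
    ∃ s < 2 ^ n, ∀ i, i ∈ s.bitIndices ↔ i ∈ T := by
  classical
  refine ⟨Nat.ofBits fun i : Fin n => decide (i.1 ∈ T), Nat.ofBits_lt_two_pow _, fun i => ?_⟩
  rw [Nat.mem_bitIndices, Nat.testBit_ofBits]
  grind

end BitSets

/-! ### Provable implication as a preorder -/

open Formula

variable {P : Type u}

/-- The Lindenbaum preorder of IntGC: `A ≤ B` means that `A → B` is provable. -/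
instance : Preorder (Formula P) where
  le A B := Provable (imp A B)
  le_refl A := .mp (.mp (.imp_s A (imp A A) A) (.imp_k A (imp A A))) (.imp_k A A)
  le_trans A B C hAB hBC := .mp (.mp (.imp_s A B C) (.mp (.imp_k _ A) hBC)) hAB

theorem galoisConnection_up_down : GaloisConnection (up (P := P)) down :=
  fun _ _ => ⟨.gc2, .gc1⟩

theorem provable_equiv_iff_antisymmRel {A B : Formula P} :
    Provable (equiv A B) ↔ AntisymmRel (· ≤ ·) A B :=
  ⟨fun h => ⟨.mp (.conj_left _ _) h, .mp (.conj_right _ _) h⟩,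
    fun h => .mp (.mp (.conj_intro _ _) h.1) h.2⟩

theorem le_of_le_imp {A B C : Formula P} (hAB : C ≤ imp A B) (hA : C ≤ A) : C ≤ B :=
  .mp (.mp (.imp_s C A B) hAB) hA

theorem le_of_provable {A B : Formula P} (hB : Provable B) : A ≤ B :=
  .mp (.imp_k B A) hB

theorem provable_down {A : Formula P} (hA : Provable A) : Provable (down A) :=
  .mp (galoisConnection_up_down.le_u (le_of_provable hA)) hA

theorem conj_down_imp_down_le (A B : Formula P) :
    conj (down (imp A B)) (down A) ≤ down B :=
  galoisConnection_up_down.le_u <| le_of_le_imp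
    (galoisConnection_up_down.l_le (Provable.conj_left _ _))
    (galoisConnection_up_down.l_le (Provable.conj_right _ _))

/-! ### Soundness -/

namespace Model

variable (M : Model.{u, v} P)

theorem sat_mono (A : Formula P) {x y : M.World} (hxy : M.le x y) (hx : M.Sat x A) :
    M.Sat y A := by
  induction A with
  | var p => exact M.val_persistent p x y hxy hx
  | neg A _ => exact fun z hz => hx z (M.le_trans _ _ _ hxy hz)
  | imp A B _ _ => exact fun z hz => hx z (M.le_trans _ _ _ hxy hz)
  | disj A B ihA ihB => exact hx.imp ihA ihB
  | conj A B ihA ihB => exact hx.imp ihA ihB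
  | up A _ =>
    obtain ⟨z, hz, hA⟩ := hx
    exact ⟨z, M.ge_R_ge _ _ _ _ hxy hz (M.le_refl z), hA⟩
  | down A _ => exact fun z hz => hx z (M.ge_R_ge _ _ _ _ (M.le_refl z) hz hxy)

/-- The model on the frame of `M` in which the variable `p` holds where `s p` holds in `M`. -/
def subst (s : P → Formula P) : Model.{u, v} P where
  toFrame := M.toFrame
  val p := {x | M.Sat x (s p)}
  val_persistent p _ _ := M.sat_mono (s p)

theorem sat_subst (s : P → Formula P) (A : Formula P) (x : M.World) :
    (M.subst s).Sat x A ↔ M.Sat x (A.subst s) := by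
  induction A generalizing x with
  | var p => rfl
  | neg A ih => exact forall₂_congr fun y _ => not_congr (ih y)
  | imp A B ihA ihB => exact forall₂_congr fun y _ => imp_congr (ihA y) (ihB y)
  | disj A B ihA ihB => exact or_congr (ihA x) (ihB x)
  | conj A B ihA ihB => exact and_congr (ihA x) (ihB x)
  | up A ih => exact exists_congr fun y => and_congr_right fun _ => ih y
  | down A ih => exact forall₂_congr fun y _ => ih y

end Model

theorem Provable.valid {A : Formula P} (hA : Provable A) (M : Model.{u, v} P) : M.Valid A := by
  induction hA generalizing M with
  | imp_k A B => exact fun _ _ _ hA _ hz _ => M.sat_mono A hz hA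
  | imp_s A B C =>
    exact fun _ _ _ hABC _ hz hAB w hw hA =>
      hABC w (M.le_trans _ _ _ hz hw) hA w (M.le_refl w) (hAB w hw hA)
  | conj_left A B => exact fun _ _ _ h => h.1
  | conj_right A B => exact fun _ _ _ h => h.2
  | conj_intro A B => exact fun _ _ _ hA _ hz hB => ⟨M.sat_mono A hz hA, hB⟩
  | disj_left A B => exact fun _ _ _ h => .inl h
  | disj_right A B => exact fun _ _ _ h => .inr h
  | disj_elim A B C =>
    exact fun _ _ _ hAC _ hz hBC w hw h => h.elim (hAC w (M.le_trans _ _ _ hz hw)) (hBC w hw)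
  | neg_intro A B =>
    exact fun _ _ _ hAB _ hz hAnB w hw hA =>
      hAnB w hw hA w (M.le_refl w) (hAB w (M.le_trans _ _ _ hz hw) hA)
  | neg_elim A B => exact fun _ _ _ hnA z hz hA => (hnA z hz hA).elim
  | subst s _ ih => exact fun x => (M.sat_subst s _ x).1 (ih (M.subst s) x)
  | mp _ _ ihAB ihA => exact fun x => ihAB M x x (M.le_refl x) (ihA M x)
  | gc1 _ ih => exact fun _ y _ ⟨z, hyz, hA⟩ => ih M z z (M.le_refl z) hA y hyz
  | gc2 _ ih => exact fun _ y _ hA z hzy => ih M z z (M.le_refl z) ⟨y, hzy, hA⟩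

theorem Model.sat_of_le (M : Model.{u, v} P) {A B : Formula P} (hAB : A ≤ B) {x : M.World}
    (hA : M.Sat x A) : M.Sat x B :=
  hAB.valid M x x (M.le_refl x) hA

/-! ### Prime theories -/

/-- A set of formulas that contains the provable ones and is closed under modus ponens. -/
structure IsTheory (T : Set (Formula P)) : Prop where
  mem_of_provable : ∀ {A}, Provable A → A ∈ T
  mp : ∀ {A B}, imp A B ∈ T → A ∈ T → B ∈ T

/-- The theory generated by the theory `T` and the formula `A`; that it is given by the
implications in `T` is the deduction theorem. -/
def adjoin (T : Set (Formula P)) (A : Formula P) : Set (Formula P) := {B | imp A B ∈ T}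

/-- A consistent theory with the disjunction property. As there is no falsum, consistency says
that some formula is missing. -/
structure IsPrimeTheory (T : Set (Formula P)) : Prop extends IsTheory T where
  exists_notMem : ∃ A, A ∉ T
  mem_or_mem : ∀ {A B}, disj A B ∈ T → A ∈ T ∨ B ∈ T

theorem isTheory_provable : IsTheory {A : Formula P | Provable A} := ⟨id, .mp⟩

theorem isTheory_Ici (A : Formula P) : IsTheory (Set.Ici A) := ⟨le_of_provable, le_of_le_imp⟩

theorem isTheory_sUnion {c : Set (Set (Formula P))} (hne : c.Nonempty)
    (hchain : IsChain (· ⊆ ·) c) (hc : ∀ T ∈ c, IsTheory T) : IsTheory (⋃₀ c) where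
  mem_of_provable hA := hne.elim fun T hT => ⟨T, hT, (hc T hT).mem_of_provable hA⟩
  mp := by
    rintro A B ⟨T, hT, hAB⟩ ⟨U, hU, hA⟩
    rcases hchain.total hT hU with hTU | hUT
    · exact ⟨U, hU, (hc U hU).mp (hTU hAB) hA⟩
    · exact ⟨T, hT, (hc T hT).mp hAB (hUT hA)⟩

namespace IsTheory

variable {T I : Set (Formula P)} {A B C : Formula P}

theorem mem_of_le (hT : IsTheory T) (hAB : A ≤ B) (hA : A ∈ T) : B ∈ T :=
  hT.mp (hT.mem_of_provable hAB) hA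

theorem conj_mem_iff (hT : IsTheory T) : conj A B ∈ T ↔ A ∈ T ∧ B ∈ T :=
  ⟨fun h => ⟨hT.mem_of_le (Provable.conj_left A B) h, hT.mem_of_le (Provable.conj_right A B) h⟩,
    fun h => hT.mp (hT.mem_of_le (Provable.conj_intro A B) h.1) h.2⟩

theorem subset_adjoin (hT : IsTheory T) : T ⊆ adjoin T A :=
  fun B => hT.mem_of_le (Provable.imp_k B A)

theorem mem_adjoin_self (hT : IsTheory T) : A ∈ adjoin T A :=
  hT.mem_of_provable (le_refl A)

theorem isTheory_adjoin (hT : IsTheory T) : IsTheory (adjoin T A) where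
  mem_of_provable hB := hT.subset_adjoin (hT.mem_of_provable hB)
  mp hBC hB := hT.mp (hT.mem_of_le (Provable.imp_s _ _ _) hBC) hB

theorem isTheory_preimage_down (hT : IsTheory T) : IsTheory (down ⁻¹' T) where
  mem_of_provable hA := hT.mem_of_provable (provable_down hA)
  mp hAB hA := hT.mem_of_le (conj_down_imp_down_le _ _) (hT.conj_mem_iff.2 ⟨hAB, hA⟩)

theorem mem_of_disj_mem (hT : IsTheory T) (hAB : disj A B ∈ T) (hA : C ∈ adjoin T A)
    (hB : C ∈ adjoin T B) : C ∈ T :=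
  hT.mp (hT.mp (hT.mem_of_le (Provable.disj_elim A B C) hA) hB) hAB

theorem exists_maximal_disjoint (hT : IsTheory T) (hTI : Disjoint T I) :
    ∃ U, T ⊆ U ∧ Maximal (fun U => IsTheory U ∧ Disjoint U I) U :=
  zorn_subset_nonempty {U | IsTheory U ∧ Disjoint U I}
    (fun c hc hchain hne => ⟨⋃₀ c,
      ⟨isTheory_sUnion hne hchain fun _ hU => (hc hU).1,
        Set.disjoint_sUnion_left.2 fun _ hU => (hc hU).2⟩,
      fun _ => Set.subset_sUnion_of_mem⟩) T ⟨hT, hTI⟩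

theorem exists_mem_adjoin_of_maximal
    (hT : Maximal (fun U => IsTheory U ∧ Disjoint U I) T) (hA : A ∉ T) :
    ∃ C ∈ I, C ∈ adjoin T A := by
  by_contra! hI
  have hadjoin : IsTheory (adjoin T A) ∧ Disjoint (adjoin T A) I :=
    ⟨hT.prop.1.isTheory_adjoin, Set.disjoint_right.2 hI⟩
  exact hA (hT.le_of_ge hadjoin hT.prop.1.subset_adjoin hT.prop.1.mem_adjoin_self)

theorem isPrimeTheory_of_maximal (hI : I.Nonempty) (hdir : DirectedOn (· ≤ ·) I)
    (hT : Maximal (fun U => IsTheory U ∧ Disjoint U I) T) : IsPrimeTheory T := by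
  obtain ⟨hTheory, hTI⟩ := hT.prop
  refine ⟨hTheory, hI.imp fun _ hC => Set.disjoint_right.1 hTI hC, fun {A B} hAB => ?_⟩
  by_contra! hcon
  obtain ⟨C, hCI, hC⟩ := exists_mem_adjoin_of_maximal hT hcon.1
  obtain ⟨D, hDI, hD⟩ := exists_mem_adjoin_of_maximal hT hcon.2
  obtain ⟨E, hEI, hCE, hDE⟩ := hdir C hCI D hDI
  exact Set.disjoint_left.1 hTI (hTheory.mem_of_disj_mem hAB
    (hTheory.isTheory_adjoin.mem_of_le hCE hC) (hTheory.isTheory_adjoin.mem_of_le hDE hD)) hEI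

theorem exists_isPrimeTheory_disjoint (hT : IsTheory T) (hI : I.Nonempty)
    (hdir : DirectedOn (· ≤ ·) I) (hTI : Disjoint T I) :
    ∃ U, IsPrimeTheory U ∧ T ⊆ U ∧ Disjoint U I := by
  obtain ⟨U, hTU, hU⟩ := hT.exists_maximal_disjoint hTI
  exact ⟨U, isPrimeTheory_of_maximal hI hdir hU, hTU, hU.prop.2⟩

theorem exists_isPrimeTheory_notMem (hT : IsTheory T) (hA : A ∉ T) :
    ∃ U, IsPrimeTheory U ∧ T ⊆ U ∧ A ∉ U := by
  simpa only [Set.disjoint_singleton_right] using hT.exists_isPrimeTheory_disjoint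
    (Set.singleton_nonempty A) (directedOn_singleton A) (Set.disjoint_singleton_right.2 hA)

theorem neg_mem_of_mem_adjoin (hT : IsTheory T) (h : neg A ∈ adjoin T A) : neg A ∈ T :=
  hT.mp (hT.mem_of_le (Provable.neg_intro A A) hT.mem_adjoin_self) h

theorem neg_mem_iff (hT : IsTheory T) :
    neg A ∈ T ↔ ∀ U, IsPrimeTheory U → T ⊆ U → A ∉ U := by
  refine ⟨fun hneg U hU hTU hA => ?_, fun h => by_contra fun hneg => ?_⟩
  · obtain ⟨B, hB⟩ := hU.exists_notMem
    exact hB (hU.mp (hU.mem_of_le (Provable.neg_elim A B) (hTU hneg)) hA)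
  · obtain ⟨U, hU, hTU, -⟩ :=
      hT.isTheory_adjoin.exists_isPrimeTheory_notMem (mt hT.neg_mem_of_mem_adjoin hneg)
    exact h U hU (hT.subset_adjoin.trans hTU) (hTU hT.mem_adjoin_self)

theorem imp_mem_iff (hT : IsTheory T) :
    imp A B ∈ T ↔ ∀ U, IsPrimeTheory U → T ⊆ U → A ∈ U → B ∈ U := by
  refine ⟨fun himp U hU hTU => hU.mp (hTU himp), fun h => by_contra fun himp => ?_⟩
  obtain ⟨U, hU, hTU, hB⟩ := hT.isTheory_adjoin.exists_isPrimeTheory_notMem himp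
  exact hB (h U hU (hT.subset_adjoin.trans hTU) (hTU hT.mem_adjoin_self))

theorem down_mem_iff (hT : IsTheory T) :
    down A ∈ T ↔ ∀ U, IsPrimeTheory U → down ⁻¹' T ⊆ U → A ∈ U := by
  refine ⟨fun hdown U _ hTU => hTU hdown, fun h => by_contra fun hdown => ?_⟩
  obtain ⟨U, hU, hTU, hA⟩ := hT.isTheory_preimage_down.exists_isPrimeTheory_notMem hdown
  exact hA (h U hU hTU)

end IsTheory

namespace IsPrimeTheory

variable {T : Set (Formula P)} {A B : Formula P}

theorem disj_mem_iff (hT : IsPrimeTheory T) : disj A B ∈ T ↔ A ∈ T ∨ B ∈ T :=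
  ⟨hT.mem_or_mem, fun h => h.elim (hT.mem_of_le (Provable.disj_left A B))
    (hT.mem_of_le (Provable.disj_right A B))⟩

theorem directedOn_image_down_compl (hT : IsPrimeTheory T) :
    DirectedOn (· ≤ ·) (down '' Tᶜ) := by
  rintro _ ⟨A, hA, rfl⟩ _ ⟨B, hB, rfl⟩
  exact ⟨_, ⟨disj A B, fun h => (hT.mem_or_mem h).elim hA hB, rfl⟩,
    galoisConnection_up_down.monotone_u (Provable.disj_left A B),
    galoisConnection_up_down.monotone_u (Provable.disj_right A B)⟩

theorem disjoint_Ici_image_down_compl (hT : IsPrimeTheory T) (hA : up A ∈ T) :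
    Disjoint (Set.Ici A) (down '' Tᶜ) := by
  rw [Set.disjoint_right]
  rintro _ ⟨B, hB, rfl⟩ hAB
  exact hB (hT.mem_of_le (galoisConnection_up_down.l_le hAB) hA)

theorem up_mem_iff (hT : IsPrimeTheory T) :
    up A ∈ T ↔ ∃ U, IsPrimeTheory U ∧ down ⁻¹' U ⊆ T ∧ A ∈ U := by
  refine ⟨fun hA => ?_, fun ⟨U, hU, hUT, hA⟩ =>
    hUT (hU.mem_of_le (galoisConnection_up_down.le_u_l A) hA)⟩
  obtain ⟨U, hU, hAU, hdisj⟩ := (isTheory_Ici A).exists_isPrimeTheory_disjoint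
    (Set.Nonempty.image down hT.exists_notMem) hT.directedOn_image_down_compl
    (hT.disjoint_Ici_image_down_compl hA)
  exact ⟨U, hU, fun B hB => by_contra fun hBT => Set.disjoint_left.1 hdisj hB ⟨B, hBT, rfl⟩,
    hAU Set.self_mem_Ici⟩

end IsPrimeTheory

/-! ### Completeness -/

/-- The canonical model of IntGC. If there is no variable, there is no
formula, hence no prime theory and no such model. -/
def canonicalModel (P : Type u) [Nonempty {T : Set (Formula P) // IsPrimeTheory T}] :
    Model.{u, u} P where
  World := {T : Set (Formula P) // IsPrimeTheory T}
  nonempty := inferInstance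
  le T U := T.1 ⊆ U.1
  le_refl _ := subset_rfl
  le_trans _ _ _ := Set.Subset.trans
  R T U := down ⁻¹' U.1 ⊆ T.1
  ge_R_ge _ _ _ _ hUT hUV hWV := (Set.preimage_mono hWV).trans (hUV.trans hUT)
  val p := {T | var p ∈ T.1}
  val_persistent _ _ _ hTU hT := hTU hT

theorem canonicalModel_sat_iff [Nonempty {T : Set (Formula P) // IsPrimeTheory T}]
    (A : Formula P) (T : (canonicalModel P).World) : (canonicalModel P).Sat T A ↔ A ∈ T.1 := by
  induction A generalizing T with
  | var p => rfl
  | neg A ih =>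
    simp only [Model.Sat, ih]
    exact Subtype.forall.trans T.2.neg_mem_iff.symm
  | imp A B ihA ihB =>
    simp only [Model.Sat, ihA, ihB]
    exact Subtype.forall.trans T.2.imp_mem_iff.symm
  | disj A B ihA ihB => exact (or_congr (ihA T) (ihB T)).trans T.2.disj_mem_iff.symm
  | conj A B ihA ihB => exact (and_congr (ihA T) (ihB T)).trans T.2.conj_mem_iff.symm
  | up A ih =>
    simp only [Model.Sat, ih]
    rw [T.2.up_mem_iff]
    exact ⟨fun ⟨U, hR, hA⟩ => ⟨U.1, U.2, hR, hA⟩, fun ⟨U, hU, hR, hA⟩ => ⟨⟨U, hU⟩, hR, hA⟩⟩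
  | down A ih =>
    simp only [Model.Sat, ih]
    exact Subtype.forall.trans T.2.down_mem_iff.symm

theorem exists_not_valid {A : Formula P} (hA : ¬ Provable A) :
    ∃ M : Model.{u, u} P, ¬ M.Valid A := by
  obtain ⟨T, hT, -, hAT⟩ := isTheory_provable.exists_isPrimeTheory_notMem hA
  have : Nonempty {T : Set (Formula P) // IsPrimeTheory T} := ⟨⟨T, hT⟩⟩
  exact ⟨canonicalModel P, fun h => hAT ((canonicalModel_sat_iff A ⟨T, hT⟩).1 (h _))⟩

/-! ### Filtrations -/

/-- `f` exhibits `N` as a filtration of `M` through `S`, in the general sense: `N` may carry any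
relations between the least and the greatest one for which the truth lemma `IsFiltration.sat_iff`
holds. -/
structure Model.IsFiltration {M : Model.{u, v} P} {N : Model.{u, w} P} (S : Set (Formula P))
    (f : M.World → N.World) : Prop where
  surjective : Function.Surjective f
  le_of_le : ∀ {x y}, M.le x y → N.le (f x) (f y)
  R_of_R : ∀ {x y}, M.R x y → N.R (f x) (f y)
  sat_of_le : ∀ {x y B}, N.le (f x) (f y) → B ∈ S → M.Sat x B → M.Sat y B
  sat_of_R_down : ∀ {x y B}, N.R (f x) (f y) → down B ∈ S → M.Sat y (down B) → M.Sat x B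
  sat_of_R_up : ∀ {x y B}, N.R (f x) (f y) → up B ∈ S → M.Sat y B → M.Sat x (up B)
  mem_val_iff : ∀ {x p}, var p ∈ S → (f x ∈ N.val p ↔ x ∈ M.val p)

theorem Formula.self_mem_sub (A : Formula P) : A ∈ A.sub := by
  cases A <;> simp [sub]

theorem Formula.sub_subset_sub {A B : Formula P} (hB : B ∈ A.sub) : B.sub ⊆ A.sub := by
  induction A <;> grind [sub]

theorem Formula.finite_sub (A : Formula P) : A.sub.Finite := by
  induction A <;> simp_all [sub]

/-- The immediate subformulas of a formula. -/
def Formula.args : Formula P → Set (Formula P)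
  | var _ => ∅
  | neg A | up A | down A => {A}
  | imp A B | disj A B | conj A B => {A, B}

theorem Formula.args_subset_sub (A : Formula P) : A.args ⊆ A.sub := by
  cases A <;> grind [args, sub, self_mem_sub]

theorem Formula.args_induction {motive : Formula P → Prop}
    (h : ∀ B : Formula P, (∀ C ∈ B.args, motive C) → motive B) (A : Formula P) : motive A := by
  induction A <;> apply h <;> simp_all [args]

theorem subformulaClosed_sub (A : Formula P) : SubformulaClosed A.sub :=
  fun _ hB _ hC => sub_subset_sub hB hC

theorem SubformulaClosed.mem_of_mem_args {S : Set (Formula P)} (hS : SubformulaClosed S)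
    {B C : Formula P} (hB : B ∈ S) (hC : C ∈ B.args) : C ∈ S :=
  hS B hB C (args_subset_sub B hC)

namespace Model

theorem IsFiltration.sat_iff {M : Model.{u, v} P} {N : Model.{u, w} P} {S : Set (Formula P)}
    {f : M.World → N.World} (hf : IsFiltration S f) (hS : SubformulaClosed S) {B : Formula P}
    (hB : B ∈ S) (x : M.World) : N.Sat (f x) B ↔ M.Sat x B := by
  induction B generalizing x with
  | var p => exact hf.mem_val_iff hB
  | neg B ih =>
    simp only [Sat, hf.surjective.forall, ih (hS.mem_of_mem_args hB rfl)]
    exact ⟨fun h y hxy => h y (hf.le_of_le hxy),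
      fun h y hxy => hf.sat_of_le hxy hB h y (M.le_refl y)⟩
  | imp B C ihB ihC =>
    simp only [Sat, hf.surjective.forall, ihB (hS.mem_of_mem_args hB (.inl rfl)),
      ihC (hS.mem_of_mem_args hB (.inr rfl))]
    exact ⟨fun h y hxy => h y (hf.le_of_le hxy),
      fun h y hxy => hf.sat_of_le hxy hB h y (M.le_refl y)⟩
  | disj B C ihB ihC =>
    exact or_congr (ihB (hS.mem_of_mem_args hB (.inl rfl)) x)
      (ihC (hS.mem_of_mem_args hB (.inr rfl)) x)
  | conj B C ihB ihC =>
    exact and_congr (ihB (hS.mem_of_mem_args hB (.inl rfl)) x)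
      (ihC (hS.mem_of_mem_args hB (.inr rfl)) x)
  | up B ih =>
    simp only [Sat, hf.surjective.exists, ih (hS.mem_of_mem_args hB rfl)]
    exact ⟨fun ⟨_, hxy, hy⟩ => hf.sat_of_R_up hxy hB hy,
      fun ⟨y, hxy, hy⟩ => ⟨y, hf.R_of_R hxy, hy⟩⟩
  | down B ih =>
    simp only [Sat, hf.surjective.forall, ih (hS.mem_of_mem_args hB rfl)]
    exact ⟨fun h y hyx => h y (hf.R_of_R hyx), fun h _ hyx => hf.sat_of_R_down hyx hB h⟩

theorem IsFiltration.valid_iff {M : Model.{u, v} P} {N : Model.{u, w} P} {S : Set (Formula P)}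
    {f : M.World → N.World} (hf : IsFiltration S f) (hS : SubformulaClosed S) {B : Formula P}
    (hB : B ∈ S) : N.Valid B ↔ M.Valid B :=
  hf.surjective.forall.trans (forall_congr' (hf.sat_iff hS hB))

variable (M : Model.{u, v} P)

theorem isFiltration_mk {S : Set (Formula P)} (hS : SubformulaClosed S)
    (hup : ∀ B, up B ∈ S → down (up B) ∈ S) :
    IsFiltration (N := M.filtration S) S (Quotient.mk (M.filtSetoid S)) where
  surjective := Quotient.mk_surjective
  le_of_le hxy := (M.filtration_le_mk S _ _).2 fun B _ => M.sat_mono B hxy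
  R_of_R hxy := (M.filtration_R_mk S _ _).2 fun _ _ _ hy => hy _ hxy
  sat_of_le hxy := (M.filtration_le_mk S _ _).1 hxy _
  sat_of_R_down hxy hB := (M.filtration_R_mk S _ _).1 hxy _ (hS.mem_of_mem_args hB rfl) hB
  sat_of_R_up hxy hB hy := (M.filtration_R_mk S _ _).1 hxy _ hB (hup _ hB)
    (M.sat_of_le (galoisConnection_up_down.le_u_l _) hy)
  mem_val_iff hp := M.filtration_val_mk S _ hp _

/-- The model on `W` whose relations and valuation are pulled back along `f` from those of `M`. -/
def comap {W : Type w} [Nonempty W] (f : W → M.World) : Model.{u, w} P where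
  World := W
  nonempty := inferInstance
  le x y := M.le (f x) (f y)
  le_refl x := M.le_refl (f x)
  le_trans _ _ _ := M.le_trans _ _ _
  R x y := M.R (f x) (f y)
  ge_R_ge _ _ _ _ := M.ge_R_ge _ _ _ _
  val p := f ⁻¹' M.val p
  val_persistent p _ _ := M.val_persistent p _ _

theorem isFiltration_comap {W : Type w} [Nonempty W] {f : W → M.World}
    (hf : Function.Surjective f) : IsFiltration (M := M.comap f) (N := M) Set.univ f where
  surjective := hf
  le_of_le := id
  R_of_R := id
  sat_of_le hxy _ := (M.comap f).sat_mono _ hxy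
  sat_of_R_down hxy _ hy := hy _ hxy
  sat_of_R_up hxy _ hy := ⟨_, hxy, hy⟩
  mem_val_iff _ := Iff.rfl

theorem valid_comap_iff {W : Type w} [Nonempty W] {f : W → M.World}
    (hf : Function.Surjective f) (A : Formula P) : (M.comap f).Valid A ↔ M.Valid A :=
  ((M.isFiltration_comap hf).valid_iff (fun _ _ _ _ => Set.mem_univ _) (Set.mem_univ A)).symm

end Model

/-! ### The set `Σ` -/

section Sig

variable {A : Formula P}

theorem sub_subset_Sig : A.sub ⊆ Sig A :=
  fun _ h => .inl (.inl (.inl (.inl h)))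

theorem down_up_mem_Sig {B : Formula P} (hB : up B ∈ Sig A) : down (up B) ∈ Sig A := by
  rcases hB with ((((hB | ⟨n, C, _, h⟩) | ⟨n, C, hC, h⟩) | ⟨n, C, hC, h⟩) | ⟨n, C, _, h⟩)
  · exact .inr ⟨0, B, .inl (.inl hB), rfl⟩
  · cases n with
    | zero => cases h
    | succ n => rw [Function.iterate_succ_apply'] at h; cases h
  · exact .inl (.inl (.inl (.inr ⟨n + 1, C, hC, by rw [Function.iterate_succ_apply', h]⟩)))
  · exact .inr ⟨n, C, hC, by rw [h]⟩
  · cases h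

theorem up_down_mem_Sig {B : Formula P} (hB : down B ∈ Sig A) : up (down B) ∈ Sig A := by
  rcases hB with ((((hB | ⟨n, C, hC, h⟩) | ⟨n, C, _, h⟩) | ⟨n, C, _, h⟩) | ⟨n, C, hC, h⟩)
  · exact .inl (.inl (.inr ⟨0, B, .inl (.inl hB), rfl⟩))
  · exact .inl (.inl (.inr ⟨n, C, hC, by rw [h]⟩))
  · cases h
  · cases n with
    | zero => cases h
    | succ n => rw [Function.iterate_succ_apply'] at h; cases h
  · exact .inl (.inr ⟨n + 1, C, hC, by rw [Function.iterate_succ_apply', h]⟩)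

theorem iterate_down_up_induction {motive : Formula P → Prop}
    (down_up : ∀ B, motive (up B) → motive (down (up B)))
    (up_down : ∀ B, motive (down B) → motive (up (down B)))
    {B : Formula P} (hB : motive (down B)) (n : ℕ) :
    motive ((fun D => down (up D))^[n] (down B)) ∧
      motive (up ((fun D => down (up D))^[n] (down B))) := by
  induction n with
  | zero => exact ⟨hB, up_down B hB⟩
  | succ n ih =>
    rw [Function.iterate_succ_apply']
    exact ⟨down_up _ ih.2, up_down _ (down_up _ ih.2)⟩

theorem iterate_up_down_induction {motive : Formula P → Prop}
    (down_up : ∀ B, motive (up B) → motive (down (up B)))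
    (up_down : ∀ B, motive (down B) → motive (up (down B)))
    {B : Formula P} (hB : motive (up B)) (n : ℕ) :
    motive ((fun D => up (down D))^[n] (up B)) ∧
      motive (down ((fun D => up (down D))^[n] (up B))) := by
  induction n with
  | zero => exact ⟨hB, down_up B hB⟩
  | succ n ih =>
    rw [Function.iterate_succ_apply']
    exact ⟨up_down _ ih.2, down_up _ (up_down _ ih.2)⟩

theorem Gam_induction {motive : Formula P → Prop} (sub : ∀ B ∈ A.sub, motive B)
    (down_up : ∀ B, motive (up B) → motive (down (up B)))
    (up_down : ∀ B, motive (down B) → motive (up (down B)))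
    {B : Formula P} (hB : B ∈ Gam A) : motive B := by
  rcases hB with ((hB | ⟨C, hC, rfl⟩) | ⟨C, hC, rfl⟩)
  · exact sub B hB
  · exact down_up C (sub _ hC)
  · exact up_down C (sub _ hC)

theorem Sig_induction {motive : Formula P → Prop} (sub : ∀ B ∈ A.sub, motive B)
    (down_up : ∀ B, motive (up B) → motive (down (up B)))
    (up_down : ∀ B, motive (down B) → motive (up (down B)))
    {B : Formula P} (hB : B ∈ Sig A) : motive B := by
  have hGam : ∀ C ∈ Gam A, motive C := fun _ => Gam_induction sub down_up up_down
  rcases hB with ((((hB | ⟨n, C, hC, rfl⟩) | ⟨n, C, hC, rfl⟩) | ⟨n, C, hC, rfl⟩) |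
    ⟨n, C, hC, rfl⟩)
  · exact sub B hB
  · exact (iterate_down_up_induction down_up up_down (hGam _ hC) n).1
  · exact (iterate_down_up_induction down_up up_down (hGam _ hC) n).2
  · exact (iterate_up_down_induction down_up up_down (hGam _ hC) n).1
  · exact (iterate_up_down_induction down_up up_down (hGam _ hC) n).2

theorem subformulaClosed_Sig (A : Formula P) : SubformulaClosed (Sig A) := by
  intro B hB
  refine Sig_induction (motive := fun B => B.sub ⊆ Sig A)
    (fun B hB => (sub_subset_sub hB).trans sub_subset_Sig) (fun B ih => ?_) (fun B ih => ?_) hB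
  · exact Set.insert_subset (down_up_mem_Sig (ih (self_mem_sub _))) ih
  · exact Set.insert_subset (up_down_mem_Sig (ih (self_mem_sub _))) ih

theorem antisymmRel_down_up_down (B : Formula P) :
    AntisymmRel (· ≤ ·) (down (up (down B))) (down B) :=
  ⟨galoisConnection_up_down.monotone_u (galoisConnection_up_down.l_u_le B),
    galoisConnection_up_down.le_u_l (down B)⟩

theorem antisymmRel_up_down_up (B : Formula P) :
    AntisymmRel (· ≤ ·) (up (down (up B))) (up B) :=
  ⟨galoisConnection_up_down.l_u_le (up B),
    galoisConnection_up_down.monotone_l (galoisConnection_up_down.le_u_l B)⟩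

theorem exists_antisymmRel_of_mem_Sig {B : Formula P} (hB : B ∈ Sig A) :
    ∃ C ∈ A.sub ∪ down '' A.sub ∪ up '' A.sub, AntisymmRel (· ≤ ·) B C := by
  set F := A.sub ∪ down '' A.sub ∪ up '' A.sub
  let HasRep (B : Formula P) : Prop := ∃ C ∈ F, AntisymmRel (· ≤ ·) B C
  have hasRep_of_mem {B} (hB : B ∈ F) : HasRep B := ⟨B, hB, .refl _ B⟩
  have hasRep_of_rel {B C} (hBC : AntisymmRel (· ≤ ·) B C) : HasRep C → HasRep B :=
    fun ⟨D, hD, hCD⟩ => ⟨D, hD, hBC.trans hCD⟩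
  refine Sig_induction (motive := fun B => HasRep B ∧ (∀ C, B = up C → HasRep (down B)) ∧
    ∀ C, B = down C → HasRep (up B)) (fun B hB => ?_) (fun B ih => ?_) (fun B ih => ?_) hB |>.1
  · exact ⟨hasRep_of_mem (.inl (.inl hB)), fun _ _ => hasRep_of_mem (.inl (.inr ⟨B, hB, rfl⟩)),
      fun _ _ => hasRep_of_mem (.inr ⟨B, hB, rfl⟩)⟩
  · exact ⟨ih.2.1 B rfl, nofun, fun _ _ => hasRep_of_rel (antisymmRel_up_down_up B) ih.1⟩
  · exact ⟨ih.2.2 B rfl, fun _ _ => hasRep_of_rel (antisymmRel_down_up_down B) ih.1, nofun⟩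

theorem finite_provClasses {S F : Set (Formula P)} (hF : F.Finite)
    (hS : ∀ B ∈ S, ∃ C ∈ F, AntisymmRel (· ≤ ·) B C) : (provClasses S).Finite := by
  refine (hF.image fun C => {D | D ∈ S ∧ Provable (equiv C D)}).subset ?_
  rintro _ ⟨B, hB, rfl⟩
  obtain ⟨C, hC, hBC⟩ := hS B hB
  refine ⟨C, hC, Set.ext fun D => and_congr_right fun _ => ?_⟩
  rw [provable_equiv_iff_antisymmRel, provable_equiv_iff_antisymmRel]
  exact ⟨hBC.trans, hBC.symm.trans⟩

theorem finite_provClasses_Sig (A : Formula P) : (provClasses (Sig A)).Finite :=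
  finite_provClasses ((A.finite_sub.union (A.finite_sub.image _)).union (A.finite_sub.image _))
    fun _ => exists_antisymmRel_of_mem_Sig

end Sig

/-! ### The finite model property -/

theorem Model.finite_filtration_of_finite_provClasses (M : Model.{u, v} P) {S : Set (Formula P)}
    (hS : (provClasses S).Finite) : Finite (M.filtration S).World := by
  have := hS.to_subtype
  let satisfied (a : Quotient (M.filtSetoid S)) : Set (provClasses S) :=
    {c | ∃ B ∈ c.1, M.Sat a.out B}
  have sat_of_satisfied_eq {a b B} (hab : satisfied a = satisfied b) (hB : B ∈ S)
      (h : M.Sat a.out B) : M.Sat b.out B := by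
    have ha : ⟨_, B, hB, rfl⟩ ∈ satisfied a :=
      ⟨B, ⟨hB, provable_equiv_iff_antisymmRel.2 (.refl _ B)⟩, h⟩
    obtain ⟨C, ⟨-, hBC⟩, hC⟩ := hab ▸ ha
    exact M.sat_of_le (provable_equiv_iff_antisymmRel.1 hBC).2 hC
  refine Finite.of_injective satisfied fun a b hab => ?_
  rw [← a.out_eq, ← b.out_eq]
  exact Quotient.sound fun B hB => ⟨sat_of_satisfied_eq hab hB, sat_of_satisfied_eq hab.symm hB⟩

theorem Model.filtration_Sig_valid_iff (M : Model.{u, v} P) (A : Formula P) :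
    (M.filtration (Sig A)).Valid A ↔ M.Valid A :=
  (M.isFiltration_mk (subformulaClosed_Sig A) fun _ => down_up_mem_Sig).valid_iff
    (subformulaClosed_Sig A) (sub_subset_Sig A.self_mem_sub)

theorem Model.finite_filtration_Sig (M : Model.{u, v} P) (A : Formula P) :
    Finite (M.filtration (Sig A)).World :=
  M.finite_filtration_of_finite_provClasses (finite_provClasses_Sig A)

theorem hasFMP (P : Type u) : HasFMP P := by
  intro A hA
  obtain ⟨M, hM⟩ := exists_not_valid hA
  let N := M.filtration (Sig A)
  have : Nonempty N.World := N.nonempty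
  have : Finite N.World := M.finite_filtration_Sig A
  obtain ⟨n, ⟨e⟩⟩ := Finite.exists_equiv_fin N.World
  have : Nonempty (Fin n) := e.symm.nonempty
  refine ⟨N.comap e.symm, inferInstanceAs (Finite (Fin n)), ?_⟩
  rwa [N.valid_comap_iff e.symm.surjective, M.filtration_Sig_valid_iff]

/-! ### Models coded by numbers -/

/-- The order of coded models: `w` and `w'` code worlds as bit sets, a world being the set of the
codes of formulas that hold in it. -/
def BitLe (w w' : ℕ) : Prop := ∀ c ∈ w.bitIndices, c ∈ w'.bitIndices

/-- The Galois relation of coded models: the largest relation compatible with the formulas `▽B`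
(tag `6`) and `▲B` (tag `5`) whose codes are in the bit set `s`. -/
def BitR (s w w' : ℕ) : Prop := ∀ c ∈ s.bitIndices,
  (c.unpair.1 = 6 → c ∈ w'.bitIndices → c.unpair.2 ∈ w.bitIndices) ∧
  (c.unpair.1 = 5 → c.unpair.2 ∈ w'.bitIndices → c ∈ w.bitIndices)

/-- The bit set `s` contains the codes of the immediate subformulas of the formula coded by `c`. -/
def ArgsMem (s c : ℕ) : Prop :=
  (c.unpair.1 = 1 ∨ c.unpair.1 = 5 ∨ c.unpair.1 = 6 → c.unpair.2 ∈ s.bitIndices) ∧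
  (c.unpair.1 = 2 ∨ c.unpair.1 = 3 ∨ c.unpair.1 = 4 →
    c.unpair.2.unpair.1 ∈ s.bitIndices ∧ c.unpair.2.unpair.2 ∈ s.bitIndices)

/-- The truth condition at the world `w` of the formula coded by `c`, read in the coded model whose
worlds are the elements of the bit set `W`. The disjuncts correspond to the clauses of `code`. -/
def CodeSat (s W w c : ℕ) : Prop :=
  (c.unpair.1 = 0 ∧ c ∈ w.bitIndices) ∨
  (c.unpair.1 = 1 ∧ ∀ w' ∈ W.bitIndices, BitLe w w' → c.unpair.2 ∉ w'.bitIndices) ∨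
  (c.unpair.1 = 2 ∧ ∀ w' ∈ W.bitIndices, BitLe w w' →
    c.unpair.2.unpair.1 ∈ w'.bitIndices → c.unpair.2.unpair.2 ∈ w'.bitIndices) ∨
  (c.unpair.1 = 3 ∧
    (c.unpair.2.unpair.1 ∈ w.bitIndices ∨ c.unpair.2.unpair.2 ∈ w.bitIndices)) ∨
  (c.unpair.1 = 4 ∧
    (c.unpair.2.unpair.1 ∈ w.bitIndices ∧ c.unpair.2.unpair.2 ∈ w.bitIndices)) ∨
  (c.unpair.1 = 5 ∧ ∃ w' ∈ W.bitIndices, BitR s w w' ∧ c.unpair.2 ∈ w'.bitIndices) ∨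
  (c.unpair.1 = 6 ∧ ∀ w' ∈ W.bitIndices, BitR s w' w → c.unpair.2 ∈ w'.bitIndices)

/-- The bit set `s` is closed under immediate subformulas, and the worlds in the bit set `W` contain
precisely those elements of `s` that are true in them. -/
def CodesModel (s W : ℕ) : Prop := ∀ c ∈ s.bitIndices,
  ArgsMem s c ∧ ∀ w ∈ W.bitIndices, (c ∈ w.bitIndices ↔ CodeSat s W w c)

/-- Some coded model of bounded size refutes the formula coded by `c`. -/
def Refutable (c : ℕ) : Prop :=
  ∃ s < 2 ^ (c + 1), ∃ W < 2 ^ 2 ^ (c + 1),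
    CodesModel s W ∧ c ∈ s.bitIndices ∧ ∃ w ∈ W.bitIndices, c ∉ w.bitIndices

section Primrec

variable {α : Type*} [Primcodable α] {s W w w' c : α → ℕ}

theorem primrecPred_mem_bitIndices (hc : Primrec c) (hs : Primrec s) :
    PrimrecPred fun x => c x ∈ (s x).bitIndices :=
  primrecRel_mem_bitIndices.comp hc hs

theorem primrec_unpair_fst (hc : Primrec c) : Primrec fun x => (c x).unpair.1 :=
  Primrec.fst.comp (Primrec.unpair.comp hc)

theorem primrec_unpair_snd (hc : Primrec c) : Primrec fun x => (c x).unpair.2 :=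
  Primrec.snd.comp (Primrec.unpair.comp hc)

theorem primrecPred_unpair_fst_eq (hc : Primrec c) (k : ℕ) :
    PrimrecPred fun x => (c x).unpair.1 = k :=
  Primrec.eq.comp (primrec_unpair_fst hc) (.const k)

theorem primrecPred_bitLe (hw : Primrec w) (hw' : Primrec w') :
    PrimrecPred fun x => BitLe (w x) (w' x) :=
  primrecPred_forall_mem_bitIndices hw (primrecPred_mem_bitIndices .snd (hw'.comp .fst))

theorem primrecPred_bitR (hs : Primrec s) (hw : Primrec w) (hw' : Primrec w') :
    PrimrecPred fun x => BitR (s x) (w x) (w' x) := by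
  have hd := primrec_unpair_snd (Primrec.snd (α := α) (β := ℕ))
  refine primrecPred_forall_mem_bitIndices hs (PrimrecPred.and ?_ ?_)
  · exact primrecPred_imp (primrecPred_unpair_fst_eq .snd 6) <|
      primrecPred_imp (primrecPred_mem_bitIndices .snd (hw'.comp .fst))
        (primrecPred_mem_bitIndices hd (hw.comp .fst))
  · exact primrecPred_imp (primrecPred_unpair_fst_eq .snd 5) <|
      primrecPred_imp (primrecPred_mem_bitIndices hd (hw'.comp .fst))
        (primrecPred_mem_bitIndices .snd (hw.comp .fst))

theorem primrecPred_argsMem (hs : Primrec s) (hc : Primrec c) :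
    PrimrecPred fun x => ArgsMem (s x) (c x) := by
  have htag := primrecPred_unpair_fst_eq hc
  have hd := primrec_unpair_snd hc
  exact (primrecPred_imp ((htag 1).or ((htag 5).or (htag 6)))
      (primrecPred_mem_bitIndices hd hs)).and <|
    primrecPred_imp ((htag 2).or ((htag 3).or (htag 4)))
      ((primrecPred_mem_bitIndices (primrec_unpair_fst hd) hs).and
        (primrecPred_mem_bitIndices (primrec_unpair_snd hd) hs))

theorem primrecPred_codeSat (hs : Primrec s) (hW : Primrec W) (hw : Primrec w) (hc : Primrec c) :
    PrimrecPred fun x => CodeSat (s x) (W x) (w x) (c x) := by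
  have htag := primrecPred_unpair_fst_eq hc
  have ha := primrec_unpair_snd hc
  have hb := primrec_unpair_fst ha
  have hd := primrec_unpair_snd ha
  have hmem {e : α → ℕ} (he : Primrec e) :
      PrimrecPred fun x : α × ℕ => e x.1 ∈ x.2.bitIndices :=
    primrecPred_mem_bitIndices (he.comp .fst) .snd
  have hLe : PrimrecPred fun x : α × ℕ => BitLe (w x.1) x.2 :=
    primrecPred_bitLe (hw.comp .fst) .snd
  have hR : PrimrecPred fun x : α × ℕ => BitR (s x.1) (w x.1) x.2 :=
    primrecPred_bitR (hs.comp .fst) (hw.comp .fst) .snd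
  have hR' : PrimrecPred fun x : α × ℕ => BitR (s x.1) x.2 (w x.1) :=
    primrecPred_bitR (hs.comp .fst) .snd (hw.comp .fst)
  refine .or ((htag 0).and ?_) <| .or ((htag 1).and ?_) <| .or ((htag 2).and ?_) <|
    .or ((htag 3).and ?_) <| .or ((htag 4).and ?_) <| .or ((htag 5).and ?_) ((htag 6).and ?_)
  · exact primrecPred_mem_bitIndices hc hw
  · exact primrecPred_forall_mem_bitIndices hW (primrecPred_imp hLe (hmem ha).not)
  · exact primrecPred_forall_mem_bitIndices hW
      (primrecPred_imp hLe (primrecPred_imp (hmem hb) (hmem hd)))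
  · exact (primrecPred_mem_bitIndices hb hw).or (primrecPred_mem_bitIndices hd hw)
  · exact (primrecPred_mem_bitIndices hb hw).and (primrecPred_mem_bitIndices hd hw)
  · exact primrecPred_exists_mem_bitIndices hW (hR.and (hmem ha))
  · exact primrecPred_forall_mem_bitIndices hW (primrecPred_imp hR' (hmem ha))

theorem primrecPred_codesModel (hs : Primrec s) (hW : Primrec W) :
    PrimrecPred fun x => CodesModel (s x) (W x) := by
  refine primrecPred_forall_mem_bitIndices hs <|
    (primrecPred_argsMem (hs.comp .fst) .snd).and <|
    primrecPred_forall_mem_bitIndices (hW.comp .fst) <| primrecPred_iff ?_ ?_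
  · exact primrecPred_mem_bitIndices (Primrec.snd.comp .fst) .snd
  · exact primrecPred_codeSat (hs.comp (Primrec.fst.comp .fst)) (hW.comp (Primrec.fst.comp .fst))
      .snd (Primrec.snd.comp .fst)

theorem primrecPred_refutable : PrimrecPred Refutable := by
  have hbound : Primrec fun c : ℕ => 2 ^ (c + 1) := primrec_two_pow.comp .succ
  refine primrecPred_exists_lt hbound <|
    primrecPred_exists_lt (primrec_two_pow.comp (hbound.comp .fst)) <|
    (primrecPred_codesModel (Primrec.snd.comp .fst) .snd).and <| .and ?_ <|
    primrecPred_exists_mem_bitIndices .snd (PrimrecPred.not ?_)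
  · exact primrecPred_mem_bitIndices (Primrec.fst.comp .fst) (Primrec.snd.comp .fst)
  · exact primrecPred_mem_bitIndices (Primrec.fst.comp (Primrec.fst.comp .fst)) .snd

end Primrec

/-! ### Decidability -/

section Coding

variable [Encodable P]

theorem Formula.code_le_code_of_mem_sub {A B : Formula P} (hB : B ∈ A.sub) :
    B.code ≤ A.code := by
  induction A <;> grind [sub, code, Nat.left_le_pair, Nat.right_le_pair]

theorem argsMem_code_iff {s : ℕ} {B : Formula P} :
    ArgsMem s B.code ↔ ∀ C ∈ B.args, C.code ∈ s.bitIndices := by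
  cases B <;> simp [ArgsMem, code, args]

theorem bitR_iff {S : Set (Formula P)} {s w w' : ℕ}
    (hs : ∀ c, c ∈ s.bitIndices ↔ c ∈ code '' S) : BitR s w w' ↔
      (∀ B, down B ∈ S → (down B).code ∈ w'.bitIndices → B.code ∈ w.bitIndices) ∧
      (∀ B, up B ∈ S → B.code ∈ w'.bitIndices → (up B).code ∈ w.bitIndices) := by
  simp only [BitR, hs, Set.forall_mem_image]
  refine ⟨fun h => ⟨fun B hB => ?_, fun B hB => ?_⟩, fun h B hB => ?_⟩
  · simpa [code] using (h hB).1
  · simpa [code] using (h hB).2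
  · cases B with
    | up B => simpa [code] using h.2 B hB
    | down B => simpa [code] using h.1 B hB
    | _ => simp [code]

theorem code_mem_bitIndices_iff_sat {M : Model.{u, v} P} {S : Set (Formula P)} {x : M.World}
    {w : ℕ} (hw : ∀ c, c ∈ w.bitIndices ↔ c ∈ code '' {B ∈ S | M.Sat x B}) {B : Formula P}
    (hB : B ∈ S) : B.code ∈ w.bitIndices ↔ M.Sat x B :=
  (hw _).trans (code_injective.mem_set_image.trans (and_iff_right hB))

section CodeSat

variable {s W w : ℕ} (A B : Formula P)

theorem codeSat_var (p : P) : CodeSat s W w (var p).code ↔ (var p).code ∈ w.bitIndices := by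
  simp [CodeSat, code]

theorem codeSat_neg : CodeSat s W w (neg A).code ↔
    ∀ w' ∈ W.bitIndices, BitLe w w' → A.code ∉ w'.bitIndices := by
  simp [CodeSat, code]

theorem codeSat_imp : CodeSat s W w (imp A B).code ↔
    ∀ w' ∈ W.bitIndices, BitLe w w' → A.code ∈ w'.bitIndices → B.code ∈ w'.bitIndices := by
  simp [CodeSat, code]

theorem codeSat_disj : CodeSat s W w (disj A B).code ↔
    A.code ∈ w.bitIndices ∨ B.code ∈ w.bitIndices := by
  simp [CodeSat, code]

theorem codeSat_conj : CodeSat s W w (conj A B).code ↔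
    A.code ∈ w.bitIndices ∧ B.code ∈ w.bitIndices := by
  simp [CodeSat, code]

theorem codeSat_up : CodeSat s W w (up A).code ↔
    ∃ w' ∈ W.bitIndices, BitR s w w' ∧ A.code ∈ w'.bitIndices := by
  simp [CodeSat, code]

theorem codeSat_down : CodeSat s W w (down A).code ↔
    ∀ w' ∈ W.bitIndices, BitR s w' w → A.code ∈ w'.bitIndices := by
  simp [CodeSat, code]

end CodeSat

/-- The model coded by `s` and `W`. -/
def codedModel (P : Type u) [Encodable P] (s W : ℕ) [Nonempty {w // w ∈ W.bitIndices}] :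
    Model.{u, 0} P where
  World := {w // w ∈ W.bitIndices}
  nonempty := inferInstance
  le x y := BitLe x y
  le_refl _ _ := id
  le_trans _ _ _ hxy hyz c hc := hyz c (hxy c hc)
  R x y := BitR s x y
  ge_R_ge _ _ _ _ hyx hyz hwz c hc :=
    ⟨fun htag hw => hyx _ ((hyz c hc).1 htag (hwz _ hw)),
      fun htag hw => hyx _ ((hyz c hc).2 htag (hwz _ hw))⟩
  val p := {x | (var p).code ∈ x.1.bitIndices}
  val_persistent _ _ _ hxy := hxy _

variable {s W : ℕ} [Nonempty {w // w ∈ W.bitIndices}]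

theorem codedModel_sat_iff_codeSat {B : Formula P}
    (hB : ∀ C ∈ B.args, ∀ y, (codedModel P s W).Sat y C ↔ C.code ∈ y.1.bitIndices)
    (x : (codedModel P s W).World) : (codedModel P s W).Sat x B ↔ CodeSat s W x.1 B.code := by
  cases B with
  | var p => exact (codeSat_var p).symm
  | neg B =>
    simp only [Model.Sat, hB B rfl, codeSat_neg]
    exact Subtype.forall
  | imp B C =>
    simp only [Model.Sat, hB B (.inl rfl), hB C (.inr rfl), codeSat_imp]
    exact Subtype.forall
  | disj B C => simp only [Model.Sat, hB B (.inl rfl), hB C (.inr rfl), codeSat_disj]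
  | conj B C => simp only [Model.Sat, hB B (.inl rfl), hB C (.inr rfl), codeSat_conj]
  | up B =>
    simp only [Model.Sat, hB B rfl, codeSat_up]
    exact ⟨fun ⟨y, hy⟩ => ⟨y.1, y.2, hy⟩, fun ⟨w, hw, h⟩ => ⟨⟨w, hw⟩, h⟩⟩
  | down B =>
    simp only [Model.Sat, hB B rfl, codeSat_down]
    exact Subtype.forall

theorem codedModel_sat_iff (hW : CodesModel s W) {B : Formula P} (hB : B.code ∈ s.bitIndices)
    (x : (codedModel P s W).World) :
    (codedModel P s W).Sat x B ↔ B.code ∈ x.1.bitIndices := by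
  induction B using args_induction generalizing x with
  | h B ih =>
    have hargs := argsMem_code_iff.1 (hW _ hB).1
    rw [codedModel_sat_iff_codeSat fun C hC y => ih C hC (hargs C hC) y]
    exact ((hW _ hB).2 x.1 x.2).symm

theorem codesModel_of_codedModel_sat_iff {S : Set (Formula P)} (hS : SubformulaClosed S)
    (hs : ∀ c, c ∈ s.bitIndices ↔ c ∈ code '' S)
    (hsat : ∀ B ∈ S, ∀ x, (codedModel P s W).Sat x B ↔ B.code ∈ x.1.bitIndices) :
    CodesModel s W := by
  intro c hc
  obtain ⟨B, hB, rfl⟩ := (hs c).1 hc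
  refine ⟨argsMem_code_iff.2 fun C hC => (hs _).2 ⟨C, hS.mem_of_mem_args hB hC, rfl⟩,
    fun w hw => (hsat B hB ⟨w, hw⟩).symm.trans ?_⟩
  exact codedModel_sat_iff_codeSat (fun C hC => hsat C (hS.mem_of_mem_args hB hC)) ⟨w, hw⟩

theorem isFiltration_codedModel {M : Model.{u, v} P} {S : Set (Formula P)}
    (hS : SubformulaClosed S) (hs : ∀ c, c ∈ s.bitIndices ↔ c ∈ code '' S) {mask : M.World → ℕ}
    (hmask : ∀ x c, c ∈ (mask x).bitIndices ↔ c ∈ code '' {B ∈ S | M.Sat x B})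
    (hW : ∀ w, w ∈ W.bitIndices ↔ w ∈ Set.range mask) :
    Model.IsFiltration (M := M) (N := codedModel P s W) S
      fun x => ⟨mask x, (hW _).2 ⟨x, rfl⟩⟩ := by
  have hsat {B} (hB : B ∈ S) (x) := code_mem_bitIndices_iff_sat (hmask x) hB
  have hargs {B C} (hB : B ∈ S) (hC : C ∈ B.args) (x) := hsat (hS.mem_of_mem_args hB hC) x
  exact
  { surjective := fun ⟨w, hw⟩ => ((hW w).1 hw).imp fun _ => Subtype.ext
    le_of_le := by
      intro x y hxy c hc
      obtain ⟨B, hB, rfl⟩ := (hmask x c).1 hc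
      exact (hsat hB.1 y).2 (M.sat_mono B hxy hB.2)
    R_of_R := fun {x y} hxy => (bitR_iff hs).2
      ⟨fun B hB hy => (hargs hB rfl x).2 ((hsat hB y).1 hy x hxy),
        fun B hB hy => (hsat hB x).2 ⟨y, hxy, (hargs hB rfl y).1 hy⟩⟩
    sat_of_le := fun hxy hB hx => (hsat hB _).1 (hxy _ ((hsat hB _).2 hx))
    sat_of_R_down := fun hxy hB hy =>
      (hargs hB rfl _).1 (((bitR_iff hs).1 hxy).1 _ hB ((hsat hB _).2 hy))
    sat_of_R_up := fun hxy hB hy =>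
      (hsat hB _).1 (((bitR_iff hs).1 hxy).2 _ hB ((hargs hB rfl _).2 hy))
    mem_val_iff := fun hp => hsat hp _ }

end Coding

theorem refutable_of_not_valid [Encodable P] {M : Model.{u, v} P} {A : Formula P}
    (hA : ¬ M.Valid A) : Refutable A.code := by
  have code_lt {B} (hB : B ∈ A.sub) : B.code < A.code + 1 :=
    Nat.lt_succ_of_le (code_le_code_of_mem_sub hB)
  obtain ⟨s, hs_lt, hs⟩ := exists_mem_bitIndices_iff (T := code '' A.sub) (n := A.code + 1) <|
    Set.forall_mem_image.2 fun _ => code_lt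
  choose mask hmask_lt hmask using fun x => exists_mem_bitIndices_iff
    (T := code '' {B ∈ A.sub | M.Sat x B}) (n := A.code + 1) <|
      Set.forall_mem_image.2 fun _ hB => code_lt hB.1
  obtain ⟨W, hW_lt, hW⟩ := exists_mem_bitIndices_iff (T := Set.range mask)
    (Set.forall_mem_range.2 hmask_lt)
  have : Nonempty {w // w ∈ W.bitIndices} := M.nonempty.map fun x => ⟨mask x, (hW _).2 ⟨x, rfl⟩⟩
  have hfilt := isFiltration_codedModel (subformulaClosed_sub A) hs hmask hW
  have hsat {B} (hB : B ∈ A.sub) (x) := code_mem_bitIndices_iff_sat (hmask x) hB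
  have hmodel : CodesModel s W := by
    refine codesModel_of_codedModel_sat_iff (subformulaClosed_sub A) hs fun B hB =>
      hfilt.surjective.forall.2 fun x => ?_
    rw [hfilt.sat_iff (subformulaClosed_sub A) hB, hsat hB]
  obtain ⟨x, hx⟩ := not_forall.1 hA
  exact ⟨s, hs_lt, W, hW_lt, hmodel, (hs _).2 ⟨A, A.self_mem_sub, rfl⟩, mask x,
    (hW _).2 ⟨x, rfl⟩, mt (hsat A.self_mem_sub x).1 hx⟩

theorem Refutable.not_provable [Encodable P] {A : Formula P} (h : Refutable A.code) :
    ¬ Provable A := by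
  obtain ⟨s, -, W, -, hW, hA, w, hw, hwA⟩ := h
  have : Nonempty {w // w ∈ W.bitIndices} := ⟨⟨w, hw⟩⟩
  exact fun h => hwA ((codedModel_sat_iff hW hA ⟨w, hw⟩).1 (h.valid _ _))

theorem refutable_code_iff [Encodable P] {A : Formula P} :
    Refutable A.code ↔ ¬ Provable A :=
  ⟨Refutable.not_provable, fun hA => (exists_not_valid hA).elim fun _ => refutable_of_not_valid⟩

theorem isDecidable (P : Type u) [Encodable P] : IsDecidable P := by
  classical
  refine ⟨fun c => decide (¬ Refutable c), primrecPred_refutable.not.decide.to_comp, fun A => ?_⟩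
  rw [decide_eq_true_iff, refutable_code_iff, not_not]

end IntGC

theorem proposition3p8 (P : Type u) [Encodable P] :
    IntGC.HasFMP P ∧
    (∀ A : IntGC.Formula P,
      A ∈ IntGC.Sig A ∧
      IntGC.SubformulaClosed (IntGC.Sig A) ∧
      (IntGC.provClasses (IntGC.Sig A)).Finite ∧
      ∀ M : IntGC.Model.{u, v} P, ¬ M.Valid A →
        Finite (M.filtration (IntGC.Sig A)).World ∧ ¬ (M.filtration (IntGC.Sig A)).Valid A) ∧
    IntGC.IsDecidable P :=
  ⟨IntGC.hasFMP P,
    fun A => ⟨IntGC.sub_subset_Sig A.self_mem_sub, IntGC.subformulaClosed_Sig A,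
      IntGC.finite_provClasses_Sig A,
      fun M hM => ⟨M.finite_filtration_Sig A, mt (M.filtration_Sig_valid_iff A).1 hM⟩⟩,
    IntGC.isDecidable P⟩
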